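/- **Theorem (Completeness with respect to bi-valued BT-models).** Let $Ags$ be a finite set of agents and $P$ a countable set of atoms. The formulas of $\mathcal L_{KO}$ are $$\phi ::= p \mid \neg\phi \mid \phi\wedge\psi \mid \Box\phi \mid [\alpha]\phi \mid K_\alpha\phi \mid \odot[\alpha]\phi \mid \odot_{\mathcal S}[\alpha]\phi \qquad (p\in P,\ \alpha\in Ags),$$ with $\to,\vee$ the usual abbreviations and $\Diamond=\neg\Box\neg$. Let $\Lambda$ be the proof system with all classical tautologies, the $\mathbf{S5}$ schemata $(K),(T),(4),(5)$ for $\Box$, $[\alpha]$ and $K_\alpha$, the schemata - $(A1)$ $\odot[\alpha](\phi\to\psi)\to(\odot[\alpha]\phi\to\odot[\alpha]\psi)$; - $(A2)$ $\Box\phi\to[\alpha]\phi\wedge\odot[\alpha]\phi$; - $(A3)$ $\Box\odot[\alpha]\phi\vee\Box\neg\odot[\alpha]\phi$; - $(A4)$ $\odot[\alpha]\phi\to\odot[\alpha][\alpha]\phi$; - $(Oic)$ $\odot[\alpha]\phi\to\Diamond[\alpha]\phi$; - $(IA)$ $\bigwedge_{1\le k\le n}\Diamond[\alpha_k]\phi_k\to\Diamond\bigwedge_{1\le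 k\le n}[\alpha_k]\phi_k$ for $n\ge1$ and pairwise different $\alpha_1,\dots,\alpha_n$; - $(A5)$ $\odot_{\mathcal S}[\alpha](\phi\to\psi)\to(\odot_{\mathcal S}[\alpha]\phi\to\odot_{\mathcal S}[\alpha]\psi)$; - $(A6)$ $\odot_{\mathcal S}[\alpha]\phi\to\odot_{\mathcal S}[\alpha]K_\alpha\phi$; - $(OAC)$ $K_\alpha\phi\to[\alpha]\phi$; - $(\text{Unif-}H)$ $\Diamond K_\alpha\phi\to K_\alpha\Diamond\phi$; - $(s.N)$ $K_\alpha\Box\phi\to\odot_{\mathcal S}[\alpha]\phi$; - $(s.Oic)$ $\odot_{\mathcal S}[\alpha]\phi\to\Diamond K_\alpha\phi$; - $(Cl)$ $\odot_{\mathcal S}[\alpha]\phi\to K_\alpha\Box\odot_{\mathcal S}[\alpha]\phi$; and the rules of modus ponens, uniform substitution, and necessitation for all the modal operators. A formula $\phi$ is *$\Lambda$-consistent* if $\not\vdash_\Lambda\neg\phi$. An *epistemic act-utilitarian bi-valued BT-frame* consists of the following. - A non-empty set $T$ of moments with a strict partial order $\sqsubset$ such that any two $\sqsubset$-predecessors of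 a moment are equal or comparable. Histories are the maximal $\sqsubset$-chains; $H_m$ is the set of histories containing $m$; situations are pairs $\langle m,h\rangle$ with $h\in H_m$. - For each $\alpha\in Ags$ and $m\in T$, a partition $Choice^m_\alpha$ (not necessarily finite) of $H_m$ such that: (NC) if $h,h'\in H_m$ share a moment later than $m$, then they lie in the same cell of $Choice^m_\alpha$; (IA) for every $s$ with $s(\alpha)\in Choice^m_\alpha$ for all $\alpha$, some $h\in H_m$ lies in every $s(\alpha)$. - For each $\alpha\in Ags$, an equivalence relation $\sim_\alpha$ on situations such that: (OAC) if $\langle m_*,h_*\rangle\sim_\alpha\langle m,h\rangle$ and $h'_*$ is in the same cell of $Choice^{m_*}_\alpha$ as $h_*$, then $\langle m_*,h_*'\rangle\sim_\alpha\langle m,h\rangle$; (Unif-H) if $\langle m_*,h_*\rangle\sim_\alpha\langle m,h\rangle$ and $h_*'\in H_{m_*}$, then $\langle m_*,h_*'\rangle\sim_\alpha\langle m,h'\rangle$ for some $h'\in H_m$. - Two functions $Value_{\mathcal O},Value_{\mathcal S}$ from histories to $\mathbb R$. A *model* adds a valuation $\mathcal V:P\to 2^{T\times H}$, where $H$ is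 the set of all histories. Let $State^m_\alpha$ be the set of all $H_m\cap\bigcap_{\beta\ne\alpha}s(\beta)$, for $s$ with $s(\beta)\in Choice^m_\beta$ for all $\beta\in Ags$. Write $m\sim_\alpha m'$ if $\langle m,h\rangle\sim_\alpha\langle m',h'\rangle$ for some $h,h'$. For a set $L$ of histories through $m_*$, put $[L]^m_\alpha=\{h\in H_m:\exists h_*\in L,\ \langle m_*,h_*\rangle\sim_\alpha\langle m,h\rangle\}$. For $L,L'\in Choice^{m}_\alpha$, let $L\preceq L'$ iff $Value_{\mathcal O}(h)\le Value_{\mathcal O}(h')$ for all $S\in State^m_\alpha$, $h\in L\cap S$, $h'\in L'\cap S$; let $L\preceq_s L'$ iff $Value_{\mathcal S}(h)\le Value_{\mathcal S}(h')$ for all $m'$ with $m\sim_\alpha m'$, $S\in State^{m'}_\alpha$, $h\in[L]^{m'}_\alpha\cap S$, $h'\in[L']^{m'}_\alpha\cap S$. Let $\prec,\prec_s$ be the strict parts ($L\prec L'$ iff $L\preceq L'$ and not $L'\preceq L$, and likewise for $\prec_s$). Truth at a situation $\langle m,h\rangle$, with $|\phi|^m=\{h\in H_m:\langle m,h\rangle\models\phi\}$,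 is given by the usual clauses for atoms (via $\mathcal V$), $\neg$ and $\wedge$, and: - $\Box\phi$: $H_m\subseteq|\phi|^m$; - $[\alpha]\phi$: the cell of $Choice^m_\alpha$ containing $h$ is a subset of $|\phi|^m$; - $K_\alpha\phi$: $\phi$ holds at every situation $\sim_\alpha$-related to $\langle m,h\rangle$; - $\odot[\alpha]\phi$: for every $L\in Choice^m_\alpha$ with $L\not\subseteq|\phi|^m$ there is $L'\in Choice^m_\alpha$ with $L\prec L'$ such that $L''\subseteq|\phi|^m$ for every $L''\in Choice^m_\alpha$ with $L''=L'$ or $L'\preceq L''$; - $\odot_{\mathcal S}[\alpha]\phi$: for every $L\in Choice^m_\alpha$ such that $[L]^{m'}_\alpha\not\subseteq|\phi|^{m'}$ for some $m'$ with $m\sim_\alpha m'$, there is $L'\in Choice^m_\alpha$ with $L\prec_s L'$ such that, for every $L''\in Choice^m_\alpha$ with $L''=L'$ or $L'\preceq_s L''$ and every $m''$ with $m\sim_\alpha m''$, $[L'']^{m''}_\alpha\subseteq|\phi|^{m''}$. Then every $\Lambda$-consistent formula of $\mathcal L_{KO}$ is true at some situation of some epistemic act-utilitarian bi-valued BT-model.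 -/

import Mathlib

universe u v w

namespace StitKO

/-! ### Syntax -/

/-- Formulas of the language `L_KO` over agents `Ags` and atoms `P`. -/
inductive Formula (Ags : Type u) (P : Type v) : Type (max u v)
  | atom : P → Formula Ags P
  | neg : Formula Ags P → Formula Ags P
  | conj : Formula Ags P → Formula Ags P → Formula Ags P
  /-- historical necessity -/
  | box : Formula Ags P → Formula Ags P
  /-- the agent sees to it that -/
  | stit : Ags → Formula Ags P → Formula Ags P
  /-- the agent knows that -/
  | know : Ags → Formula Ags P → Formula Ags P
  /-- the agent objectively ought to see to it that -/
  | oughtO : Ags → Formula Ags P → Formula Ags P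
  /-- the agent subjectively ought to see to it that -/
  | oughtS : Ags → Formula Ags P → Formula Ags P

namespace Formula

variable {Ags : Type u} {P : Type v}

/-- Material implication. -/
def imp (φ ψ : Formula Ags P) : Formula Ags P := neg (conj φ (neg ψ))

/-- Disjunction. -/
def disj (φ ψ : Formula Ags P) : Formula Ags P := neg (conj (neg φ) (neg ψ))

/-- Historical possibility. -/
def dia (φ : Formula Ags P) : Formula Ags P := neg (box (neg φ))

/-- The conjunction `f 0 ∧ (f 1 ∧ (⋯ ∧ f n))` of `n + 1` formulas. -/
def bigAnd : (n : ℕ) → (Fin (n + 1) → Formula Ags P) → Formula Ags P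
  | 0, f => f 0
  | n + 1, f => conj (f 0) (bigAnd n fun i => f i.succ)

/-- Uniform substitution of formulas for atoms. -/
def subst (σ : P → Formula Ags P) : Formula Ags P → Formula Ags P
  | atom p => σ p
  | neg φ => neg (subst σ φ)
  | conj φ ψ => conj (subst σ φ) (subst σ ψ)
  | box φ => box (subst σ φ)
  | stit α φ => stit α (subst σ φ)
  | know α φ => know α (subst σ φ)
  | oughtO α φ => oughtO α (subst σ φ)
  | oughtS α φ => oughtS α (subst σ φ)

/-- Classical tautologies in the full language: true under every assignment of truth values to
formulas that respects negation and conjunction (atoms and modal formulas being arbitrary). -/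
def IsTautology (φ : Formula Ags P) : Prop :=
  ∀ t : Formula Ags P → Prop, (∀ ψ, t (neg ψ) ↔ ¬ t ψ) →
    (∀ ψ χ, t (conj ψ χ) ↔ (t ψ ∧ t χ)) → t φ

end Formula

open Formula

/-! ### The proof system -/

/-- The four `S5` schemata for a unary operator `O`; `5` is `¬O¬φ → O¬O¬φ`. -/
inductive S5Axiom {Ags : Type u} {P : Type v} (O : Formula Ags P → Formula Ags P) :
    Formula Ags P → Prop
  | K (φ ψ) : S5Axiom O (imp (O (imp φ ψ)) (imp (O φ) (O ψ)))
  | T (φ) : S5Axiom O (imp (O φ) φ)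
  | four (φ) : S5Axiom O (imp (O φ) (O (O φ)))
  | five (φ) : S5Axiom O (imp (neg (O (neg φ))) (O (neg (O (neg φ)))))

/-- Axioms of the system `Λ`. -/
inductive Axm {Ags : Type u} {P : Type v} : Formula Ags P → Prop
  | taut {φ} : IsTautology φ → Axm φ
  | s5Box {φ} : S5Axiom box φ → Axm φ
  | s5Stit (α) {φ} : S5Axiom (stit α) φ → Axm φ
  | s5Know (α) {φ} : S5Axiom (know α) φ → Axm φ
  | A1 (α φ ψ) : Axm (imp (oughtO α (imp φ ψ)) (imp (oughtO α φ) (oughtO α ψ)))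
  | A2 (α φ) : Axm (imp (box φ) (conj (stit α φ) (oughtO α φ)))
  | A3 (α φ) : Axm (disj (box (oughtO α φ)) (box (neg (oughtO α φ))))
  | A4 (α φ) : Axm (imp (oughtO α φ) (oughtO α (stit α φ)))
  | Oic (α φ) : Axm (imp (oughtO α φ) (dia (stit α φ)))
  /-- independence of agency, for `n + 1` pairwise different agents -/
  | IA (n : ℕ) (a : Fin (n + 1) → Ags) (φ : Fin (n + 1) → Formula Ags P) :
      Function.Injective a →
      Axm (imp (bigAnd n fun i => dia (stit (a i) (φ i)))
        (dia (bigAnd n fun i => stit (a i) (φ i))))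
  | A5 (α φ ψ) : Axm (imp (oughtS α (imp φ ψ)) (imp (oughtS α φ) (oughtS α ψ)))
  | A6 (α φ) : Axm (imp (oughtS α φ) (oughtS α (know α φ)))
  | OAC (α φ) : Axm (imp (know α φ) (stit α φ))
  | UnifH (α φ) : Axm (imp (dia (know α φ)) (know α (dia φ)))
  | sN (α φ) : Axm (imp (know α (box φ)) (oughtS α φ))
  | sOic (α φ) : Axm (imp (oughtS α φ) (dia (know α φ)))
  | Cl (α φ) : Axm (imp (oughtS α φ) (know α (box (oughtS α φ))))

/-- Theorems of `Λ`: closure of the axioms under modus ponens, uniform substitution and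
necessitation for all the modal operators. -/
inductive Provable {Ags : Type u} {P : Type v} : Formula Ags P → Prop
  | ax {φ} : Axm φ → Provable φ
  | mp {φ ψ} : Provable (imp φ ψ) → Provable φ → Provable ψ
  | subst (σ : P → Formula Ags P) {φ} : Provable φ → Provable (Formula.subst σ φ)
  | necBox {φ} : Provable φ → Provable (box φ)
  | necStit (α) {φ} : Provable φ → Provable (stit α φ)
  | necKnow (α) {φ} : Provable φ → Provable (know α φ)
  | necOughtO (α) {φ} : Provable φ → Provable (oughtO α φ)
  | necOughtS (α) {φ} : Provable φ → Provable (oughtS α φ)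

/-- `φ` is `Λ`-consistent if its negation is not a theorem of `Λ`. -/
def Consistent {Ags : Type u} {P : Type v} (φ : Formula Ags P) : Prop :=
  ¬ Provable (neg φ)

/-! ### Branching-time models -/

/-- Histories: maximal chains of the moment ordering. -/
def History {T : Type w} (lt : T → T → Prop) : Type w :=
  {h : Set T // IsMaxChain lt h}

/-- `H_m`: the histories through the moment `m`. -/
def HistoriesAt {T : Type w} (lt : T → T → Prop) (m : T) : Set (History lt) :=
  {h | m ∈ h.1}

/-- Situations: moment-history pairs `⟨m, h⟩` with `m ∈ h`. -/
structure Situation {T : Type w} (lt : T → T → Prop) where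
  m : T
  h : History lt
  mem : h ∈ HistoriesAt lt m

/-- Epistemic act-utilitarian bi-valued BT-frames with set of moments `T`. There is no bound on
the number of actions available to an agent at a moment. -/
structure BTFrame (Ags : Type u) (T : Type w) where
  nonempty : Nonempty T
  /-- the moment ordering -/
  lt : T → T → Prop
  lt_irrefl : ∀ m, ¬ lt m m
  lt_trans : ∀ m₁ m₂ m₃, lt m₁ m₂ → lt m₂ m₃ → lt m₁ m₃
  no_backward_branching : ∀ m m₁ m₂, lt m₁ m → lt m₂ m → m₁ = m₂ ∨ lt m₁ m₂ ∨ lt m₂ m₁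
  /-- `choice α m` is the set of actions available to `α` at `m`, a partition of `H_m` -/
  choice : Ags → T → Set (Set (History lt))
  choice_subset : ∀ α m, ∀ L ∈ choice α m, L ⊆ HistoriesAt lt m
  choice_nonempty : ∀ α m, ∀ L ∈ choice α m, L.Nonempty
  choice_partition : ∀ α m, ∀ h ∈ HistoriesAt lt m, ∃! L, L ∈ choice α m ∧ h ∈ L
  /-- no choice between undivided histories -/
  nc : ∀ α m, ∀ h ∈ HistoriesAt lt m, ∀ h' ∈ HistoriesAt lt m,
    (∃ m', lt m m' ∧ m' ∈ h.1 ∧ m' ∈ h'.1) → ∀ L ∈ choice α m, (h ∈ L ↔ h' ∈ L)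
  /-- independence of agency -/
  ia : ∀ m, ∀ s : Ags → Set (History lt), (∀ α, s α ∈ choice α m) →
    (HistoriesAt lt m ∩ ⋂ α, s α).Nonempty
  /-- epistemic indistinguishability of situations -/
  sim : Ags → Situation lt → Situation lt → Prop
  sim_equivalence : ∀ α, Equivalence (sim α)
  /-- own action condition -/
  oac : ∀ α, ∀ s s' t : Situation lt, sim α s t → s'.m = s.m →
    (∃ L ∈ choice α s.m, s.h ∈ L ∧ s'.h ∈ L) → sim α s' t
  /-- uniformity of historical possibility -/
  unif_h : ∀ α, ∀ s s' t : Situation lt, sim α s t → s'.m = s.m →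
    ∃ t' : Situation lt, t'.m = t.m ∧ sim α s' t'
  valueO : History lt → ℝ
  valueS : History lt → ℝ

namespace BTFrame

variable {Ags : Type u} {T : Type w} (F : BTFrame Ags T)

/-- `H_m`. -/
def H (m : T) : Set (History F.lt) := HistoriesAt F.lt m

/-- The action of `α` at `m` that contains `h`. -/
def cell (α : Ags) (m : T) (h : History F.lt) : Set (History F.lt) :=
  {h' | ∃ L ∈ F.choice α m, h ∈ L ∧ h' ∈ L}

/-- `State_β^m`: intersections, inside `H_m`, of actions of all the agents other than `β`. -/
def State (β : Ags) (m : T) : Set (Set (History F.lt)) :=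
  {S | ∃ s : Ags → Set (History F.lt), (∀ α, s α ∈ F.choice α m) ∧
    S = F.H m ∩ ⋂ α ∈ {α : Ags | α ≠ β}, s α}

/-- `m ∼_α m'` for moments: some situation at `m` is indistinguishable from some one at `m'`. -/
def simMoment (α : Ags) (m m' : T) : Prop :=
  ∃ s s' : Situation F.lt, s.m = m ∧ s'.m = m' ∧ F.sim α s s'

/-- The epistemic cluster `[L]_α^m` of a set `L` of histories through `m₀`. -/
def cluster (α : Ags) (m₀ : T) (L : Set (History F.lt)) (m : T) : Set (History F.lt) :=
  {h | ∃ s s' : Situation F.lt, s.m = m₀ ∧ s.h ∈ L ∧ s'.m = m ∧ s'.h = h ∧ F.sim α s s'}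

/-- Objective weak dominance `L ⪯ L'` for `α` at `m`. -/
def domO (α : Ags) (m : T) (L L' : Set (History F.lt)) : Prop :=
  ∀ S ∈ F.State α m, ∀ h ∈ L ∩ S, ∀ h' ∈ L' ∩ S, F.valueO h ≤ F.valueO h'

/-- Objective strict dominance `L ≺ L'` for `α` at `m`. -/
def sdomO (α : Ags) (m : T) (L L' : Set (History F.lt)) : Prop :=
  F.domO α m L L' ∧ ¬ F.domO α m L' L

/-- Subjective weak dominance `L ⪯_s L'` for `α` at `m₀`. -/
def domS (α : Ags) (m₀ : T) (L L' : Set (History F.lt)) : Prop :=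
  ∀ m, F.simMoment α m₀ m → ∀ S ∈ F.State α m,
    ∀ h ∈ F.cluster α m₀ L m ∩ S, ∀ h' ∈ F.cluster α m₀ L' m ∩ S, F.valueS h ≤ F.valueS h'

/-- Subjective strict dominance `L ≺_s L'` for `α` at `m₀`. -/
def sdomS (α : Ags) (m₀ : T) (L L' : Set (History F.lt)) : Prop :=
  F.domS α m₀ L L' ∧ ¬ F.domS α m₀ L' L

/-- The histories `h` through `m` for which the situation `⟨m, h⟩` belongs to `X`. -/
def slice (X : Set (Situation F.lt)) (m : T) : Set (History F.lt) :=
  {h | ∃ hm : h ∈ HistoriesAt F.lt m, (⟨m, h, hm⟩ : Situation F.lt) ∈ X}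

end BTFrame

/-- Epistemic act-utilitarian bi-valued BT-models. -/
structure BTModel (Ags : Type u) (P : Type v) (T : Type w) extends BTFrame Ags T where
  val : P → Set (T × History lt)

namespace BTModel

variable {Ags : Type u} {P : Type v} {T : Type w} (M : BTModel Ags P T)

/-- The set of situations of `M` at which a formula is true. -/
def truth : Formula Ags P → Set (Situation M.lt)
  | atom p => {s | (s.m, s.h) ∈ M.val p}
  | neg φ => {s | s ∉ truth φ}
  | conj φ ψ => {s | s ∈ truth φ ∧ s ∈ truth ψ}
  | box φ => {s | M.H s.m ⊆ M.slice (truth φ) s.m}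
  | stit α φ => {s | M.cell α s.m s.h ⊆ M.slice (truth φ) s.m}
  | know α φ => {s | ∀ s', M.sim α s s' → s' ∈ truth φ}
  | oughtO α φ => {s | ∀ L ∈ M.choice α s.m, ¬ L ⊆ M.slice (truth φ) s.m →
      ∃ L' ∈ M.choice α s.m, M.sdomO α s.m L L' ∧
        ∀ L'' ∈ M.choice α s.m, (L'' = L' ∨ M.domO α s.m L' L'') →
          L'' ⊆ M.slice (truth φ) s.m}
  | oughtS α φ => {s | ∀ L ∈ M.choice α s.m,
      (∃ m', M.simMoment α s.m m' ∧ ¬ M.cluster α s.m L m' ⊆ M.slice (truth φ) m') →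
      ∃ L' ∈ M.choice α s.m, M.sdomS α s.m L L' ∧
        ∀ L'' ∈ M.choice α s.m, (L'' = L' ∨ M.domS α s.m L' L'') →
          ∀ m'', M.simMoment α s.m m'' →
            M.cluster α s.m L'' m'' ⊆ M.slice (truth φ) m''}

/-- `M, s ⊨ φ`. -/
def Sat (s : Situation M.lt) (φ : Formula Ags P) : Prop := s ∈ M.truth φ

end BTModel

end StitKO

/-! The proof goes through Kripke models in which each agent has a set of optimal worlds for each
kind of ought: `oughtO α φ` says that φ holds at all objectively optimal worlds of the current
`B`-class, and `oughtS α φ` that it holds at all subjectively optimal worlds of the `B`-classes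
reachable by `K α`.

The maximal theories form such a model. A theory is optimal when it contains every φ that it says
ought to hold, that is, when it sees itself along the canonical relation of the ought. (A3) and (Cl)
make oughts settled, so each ought relation factors through `B`, or through `K` and `B`, followed by
this reflexivity (`canRel_oughtS_iff`). (IA) makes compatible choices jointly realizable
(`exists_canRel_stit`).

A Kripke model then unfolds into a forest of height two: every `B`-class is a root and every world a
leaf above its class, so histories correspond to worlds. The value of a history counts the agents
for which its world is optimal. Within a state the actions of the other agents are fixed, hence so
are their contributions, and α's dominance order only compares whether α's own actions are optimal
(`domO_iff`, `domS_iff`). Optimal actions exist and nothing strictly dominates them, so the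
dominance clauses for ought reduce to truth at all optimal worlds (`toBTModel_sat`). -/

namespace StitKO

open Formula

/-! ### Maximal theories and Lindenbaum's lemma -/

section Theories

variable {Ags : Type u} {P : Type v}

/-- Sets of formulas that contain all theorems of `Λ` and are closed under modus ponens. -/
structure IsTheory (Γ : Set (Formula Ags P)) : Prop where
  provable : ∀ {φ}, Provable φ → φ ∈ Γ
  mp : ∀ {φ ψ}, imp φ ψ ∈ Γ → φ ∈ Γ → ψ ∈ Γ

theorem Provable.of_isTautology {φ : Formula Ags P} (h : IsTautology φ) : Provable φ :=
  .ax (.taut h)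

theorem IsTheory.provableSet : IsTheory {φ : Formula Ags P | Provable φ} where
  provable h := h
  mp h h' := .mp h h'

theorem IsTheory.taut {Γ : Set (Formula Ags P)} (hΓ : IsTheory Γ) {φ : Formula Ags P}
    (h : IsTautology φ) : φ ∈ Γ :=
  hΓ.provable (.of_isTautology h)

/-- The theory generated by two theories. -/
theorem IsTheory.sup {Γ Δ : Set (Formula Ags P)} (hΓ : IsTheory Γ) (hΔ : IsTheory Δ) :
    IsTheory {ψ | ∃ δ ∈ Δ, imp δ ψ ∈ Γ} where
  provable {φ} h := ⟨φ, hΔ.provable h, hΓ.taut fun t hn hc => by simp only [imp, hn, hc]; tauto⟩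
  mp := by
    rintro φ ψ ⟨δ, hδ, h⟩ ⟨δ', hδ', h'⟩
    refine ⟨conj δ δ', ?_, ?_⟩
    · refine hΔ.mp (hΔ.mp (hΔ.taut ?_) hδ) hδ'
      intro t hn hc; simp only [imp, hn, hc]; tauto
    · refine hΓ.mp (hΓ.mp (hΓ.taut ?_) h) h'
      intro t hn hc; simp only [imp, hn, hc]; tauto

/-- The theory obtained by adding a formula to a theory. -/
theorem IsTheory.adjoin {Γ : Set (Formula Ags P)} (hΓ : IsTheory Γ) (χ : Formula Ags P) :
    IsTheory {ψ | imp χ ψ ∈ Γ} where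
  provable {φ} h := hΓ.mp (hΓ.taut fun t hn hc => by simp only [imp, hn, hc]; tauto)
    (hΓ.provable h)
  mp := by
    intro φ ψ h h'
    refine hΓ.mp (hΓ.mp (hΓ.taut ?_) h) h'
    intro t hn hc; simp only [imp, hn, hc]; tauto

variable (Ags P) in
/-- Maximal `Λ`-consistent sets of formulas. -/
structure MaxTheory where
  carrier : Set (Formula Ags P)
  isTheory : IsTheory carrier
  neg_mem_iff : ∀ φ, neg φ ∈ carrier ↔ φ ∉ carrier

instance : Membership (Formula Ags P) (MaxTheory Ags P) := ⟨fun w φ => φ ∈ w.carrier⟩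

/-- Lindenbaum's lemma. -/
theorem IsTheory.exists_maxTheory {Γ : Set (Formula Ags P)} (hΓ : IsTheory Γ)
    {φ : Formula Ags P} (hφ : φ ∉ Γ) :
    ∃ w : MaxTheory Ags P, (∀ ψ ∈ Γ, ψ ∈ w) ∧ φ ∉ w := by
  obtain ⟨M, hΓM, hM⟩ := zorn_subset_nonempty {Δ : Set (Formula Ags P) | IsTheory Δ ∧ φ ∉ Δ}
    (by
      rintro c hc hchain ⟨Δ₀, hΔ₀⟩
      refine ⟨⋃₀ c, ⟨⟨fun h => ⟨Δ₀, hΔ₀, (hc hΔ₀).1.provable h⟩, ?_⟩, ?_⟩,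
        fun s hs => Set.subset_sUnion_of_mem hs⟩
      · rintro χ ψ ⟨Δ, hΔ, h⟩ ⟨Δ', hΔ', h'⟩
        rcases hchain.total hΔ hΔ' with hle | hle
        · exact ⟨Δ', hΔ', (hc hΔ').1.mp (hle h) h'⟩
        · exact ⟨Δ, hΔ, (hc hΔ).1.mp h (hle h')⟩
      · rintro ⟨Δ, hΔ, h⟩
        exact (hc hΔ).2 h) Γ ⟨hΓ, hφ⟩
  have hT : IsTheory M := hM.prop.1
  -- Otherwise the theory obtained by adjoining χ would still omit φ, against maximality.
  have key : ∀ χ, χ ∉ M → imp χ φ ∈ M := by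
    intro χ hχ
    by_contra hcon
    have hle : M ⊆ {ψ | imp χ ψ ∈ M} := fun ψ hψ =>
      hT.mp (hT.taut fun t hn hc => by simp only [imp, hn, hc]; tauto) hψ
    exact hχ (hM.le_of_ge ⟨hT.adjoin χ, hcon⟩ hle
      (hT.taut fun t hn hc => by simp only [imp, hn, hc]; tauto))
  refine ⟨⟨M, hT, fun χ => ⟨fun hn h => hM.prop.2 ?_, fun h => ?_⟩⟩, hΓM, hM.prop.2⟩
  · refine hT.mp (hT.mp (hT.taut ?_) hn) h
    intro t hn hc; simp only [imp, hn, hc]; tauto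
  · by_contra hcon
    refine hM.prop.2 (hT.mp (hT.mp (hT.taut ?_) (key _ h)) (key _ hcon))
    intro t hn hc; simp only [imp, hn, hc]; tauto

namespace MaxTheory

variable (w : MaxTheory Ags P)

theorem of_provable {φ : Formula Ags P} (h : Provable φ) : φ ∈ w := w.isTheory.provable h

theorem mem_neg {φ : Formula Ags P} : neg φ ∈ w ↔ φ ∉ w := w.neg_mem_iff φ

theorem mem_conj {φ ψ : Formula Ags P} : conj φ ψ ∈ w ↔ φ ∈ w ∧ ψ ∈ w := by
  have hT := w.isTheory
  refine ⟨fun h => ⟨hT.mp (hT.taut ?_) h, hT.mp (hT.taut ?_) h⟩,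
    fun h => hT.mp (hT.mp (hT.taut ?_) h.1) h.2⟩ <;>
  · intro t hn hc; simp only [imp, hn, hc]; tauto

theorem mem_imp {φ ψ : Formula Ags P} : imp φ ψ ∈ w ↔ (φ ∈ w → ψ ∈ w) := by
  simp only [imp, mem_neg, mem_conj]; tauto

theorem mem_disj {φ ψ : Formula Ags P} : disj φ ψ ∈ w ↔ φ ∈ w ∨ ψ ∈ w := by
  simp only [disj, mem_neg, mem_conj]; tauto

theorem mem_dia {φ : Formula Ags P} : dia φ ∈ w ↔ box (neg φ) ∉ w := by
  simp only [dia, mem_neg]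

theorem mem_of_imp {φ ψ : Formula Ags P} (h : Provable (imp φ ψ)) (hφ : φ ∈ w) : ψ ∈ w :=
  w.isTheory.mp (w.of_provable h) hφ

theorem mem_of_axm {φ ψ : Formula Ags P} (h : Axm (imp φ ψ)) (hφ : φ ∈ w) : ψ ∈ w :=
  w.mem_of_imp (.ax h) hφ

end MaxTheory

/-- Any valuation that respects conjunction is allowed, so this serves both for tautologies and for
membership in a maximal theory. -/
theorem val_bigAnd {t : Formula Ags P → Prop} (hc : ∀ ψ χ, t (conj ψ χ) ↔ (t ψ ∧ t χ)) :
    ∀ (n : ℕ) (f : Fin (n + 1) → Formula Ags P), t (bigAnd n f) ↔ ∀ i, t (f i)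
  | 0, f => by simp [bigAnd]
  | n + 1, f => by rw [bigAnd, hc, val_bigAnd hc n, Fin.forall_fin_succ (n := n + 1)]

/-! ### Normal operators and canonical relations -/

/-- Operators that satisfy `(K)` and necessitation. -/
structure IsNormal (O : Formula Ags P → Formula Ags P) : Prop where
  k : ∀ φ ψ, Provable (imp (O (imp φ ψ)) (imp (O φ) (O ψ)))
  nec : ∀ {φ}, Provable φ → Provable (O φ)

/-- Operators that satisfy the `S5` schemata and necessitation. -/
structure IsS5 (O : Formula Ags P → Formula Ags P) : Prop where
  ax : ∀ {φ}, S5Axiom O φ → Provable φ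
  nec : ∀ {φ}, Provable φ → Provable (O φ)

theorem IsS5.isNormal {O : Formula Ags P → Formula Ags P} (hO : IsS5 O) : IsNormal O where
  k φ ψ := hO.ax (.K φ ψ)
  nec := hO.nec

theorem isS5_box : IsS5 (box : Formula Ags P → Formula Ags P) where
  ax h := .ax (.s5Box h)
  nec := .necBox

theorem isS5_stit (α : Ags) : IsS5 (stit α : Formula Ags P → Formula Ags P) where
  ax h := .ax (.s5Stit α h)
  nec := .necStit α

theorem isS5_know (α : Ags) : IsS5 (know α : Formula Ags P → Formula Ags P) where
  ax h := .ax (.s5Know α h)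
  nec := .necKnow α

theorem isNormal_oughtO (α : Ags) : IsNormal (oughtO α : Formula Ags P → Formula Ags P) where
  k φ ψ := .ax (.A1 α φ ψ)
  nec := .necOughtO α

theorem isNormal_oughtS (α : Ags) : IsNormal (oughtS α : Formula Ags P → Formula Ags P) where
  k φ ψ := .ax (.A5 α φ ψ)
  nec := .necOughtS α

/-- The canonical accessibility relation of an operator. -/
def canRel (O : Formula Ags P → Formula Ags P) (w v : MaxTheory Ags P) : Prop :=
  ∀ φ, O φ ∈ w → φ ∈ v

namespace IsNormal

variable {O : Formula Ags P → Formula Ags P} (hO : IsNormal O) (w : MaxTheory Ags P)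
include hO

theorem mem_mp {φ ψ : Formula Ags P} (h : O (imp φ ψ) ∈ w) (h' : O φ ∈ w) : O ψ ∈ w :=
  w.isTheory.mp (w.mem_of_imp (hO.k φ ψ) h) h'

theorem mem_mono {φ ψ : Formula Ags P} (h : Provable (imp φ ψ)) (h' : O φ ∈ w) : O ψ ∈ w :=
  hO.mem_mp w (w.of_provable (hO.nec h)) h'

theorem isTheory : IsTheory {φ | O φ ∈ w} where
  provable h := w.of_provable (hO.nec h)
  mp := hO.mem_mp w

theorem mem_conj {φ ψ : Formula Ags P} (h : O φ ∈ w) (h' : O ψ ∈ w) : O (conj φ ψ) ∈ w := by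
  refine hO.mem_mp w (hO.mem_mono w (.of_isTautology ?_) h) h'
  intro t hn hc; simp only [imp, hn, hc]; tauto

theorem mem_of_forall {φ : Formula Ags P} (h : ∀ v, canRel O w v → φ ∈ v) : O φ ∈ w := by
  by_contra hcon
  obtain ⟨v, hv, hφ⟩ := (hO.isTheory w).exists_maxTheory (φ := φ) hcon
  exact hφ (h v hv)

end IsNormal

/-- The hypothesis says that the theories `O⁻¹w` and `O'⁻¹w'` do not refute each other, so their
join is consistent and Lindenbaum's lemma applies. The formula `φ₀` only serves to write down a
contradiction, since the language has no falsum. -/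
theorem exists_canRel_of_sup {O O' : Formula Ags P → Formula Ags P} (hO : IsNormal O)
    (hO' : IsNormal O') {w w' : MaxTheory Ags P} (φ₀ : Formula Ags P)
    (h : ∀ δ, O' δ ∈ w' → O (neg δ) ∉ w) : ∃ v, canRel O w v ∧ canRel O' w' v := by
  have hO1 := hO.isTheory w
  have hO2 := hO'.isTheory w'
  obtain ⟨v, hv, -⟩ := (hO1.sup hO2).exists_maxTheory (φ := conj φ₀ (neg φ₀)) (by
    rintro ⟨δ, hδ, hδ'⟩
    refine h δ hδ (hO.mem_mono w (.of_isTautology ?_) hδ')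
    intro t hn hc; simp only [imp, hn, hc]; tauto)
  refine ⟨v, fun ψ hψ => hv ψ ⟨imp ψ ψ, hO2.taut ?_, hO1.mp (hO1.taut ?_) hψ⟩,
    fun ψ hψ => hv ψ ⟨ψ, hψ, hO1.taut ?_⟩⟩ <;>
  · intro t hn hc; simp only [imp, hn, hc]; tauto

namespace IsS5

variable {O : Formula Ags P → Formula Ags P} (hO : IsS5 O)
include hO

theorem mem_of_mem {w : MaxTheory Ags P} {φ : Formula Ags P} (h : O φ ∈ w) : φ ∈ w :=
  w.mem_of_imp (hO.ax (.T φ)) h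

theorem mem_four {w : MaxTheory Ags P} {φ : Formula Ags P} (h : O φ ∈ w) : O (O φ) ∈ w :=
  w.mem_of_imp (hO.ax (.four φ)) h

theorem mem_five {w : MaxTheory Ags P} {φ : Formula Ags P} (h : O φ ∉ w) : O (neg (O φ)) ∈ w := by
  -- Schema (5) is applied to `¬φ`, so double negations have to be removed under `O`.
  have h1 : Provable (imp (neg (neg φ)) φ) := .of_isTautology fun t hn hc => by
    simp only [imp, hn, hc]; tauto
  have h2 : Provable (imp φ (neg (neg φ))) := .of_isTautology fun t hn hc => by
    simp only [imp, hn, hc]; tauto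
  have h3 : Provable (imp (O φ) (O (neg (neg φ)))) := .mp (hO.ax (.K _ _)) (hO.nec h2)
  have h4 : Provable (imp (neg (O (neg (neg φ)))) (neg (O φ))) := by
    refine .mp (.of_isTautology ?_) h3
    intro t hn hc; simp only [imp, hn, hc]; tauto
  refine hO.isNormal.mem_mono w h4 (w.mem_of_imp (hO.ax (.five _)) ?_)
  rw [w.mem_neg]
  exact fun h' => h (hO.isNormal.mem_mono w h1 h')

theorem equivalence : Equivalence (canRel O) where
  refl _ _ h := hO.mem_of_mem h
  symm {w v} h φ hφ := by
    by_contra hcon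
    exact (v.mem_neg.1 (h _ (hO.mem_five fun h' => hcon (hO.mem_of_mem h')))) hφ
  trans h h' φ hφ := h' _ (h _ (hO.mem_four hφ))

theorem mem_iff_forall {w : MaxTheory Ags P} {φ : Formula Ags P} :
    O φ ∈ w ↔ ∀ v, canRel O w v → φ ∈ v :=
  ⟨fun h _ hv => hv φ h, hO.isNormal.mem_of_forall w⟩

end IsS5

end Theories

/-! ### Kripke models -/

/-- Kripke models of `L_KO`: `B`, `A α` and `K α` are the accessibility relations of `box`,
`stit α` and `know α`; `optO α` and `optS α` hold the worlds that are optimal for `α`. -/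
structure KripkeModel (Ags : Type u) (P : Type v) (W : Type w) where
  B : Setoid W
  A : Ags → Setoid W
  K : Ags → Setoid W
  optO : Ags → W → Prop
  optS : Ags → W → Prop
  val : P → W → Prop
  A_le_B : ∀ {α w v}, A α w v → B w v
  A_le_K : ∀ {α w v}, A α w v → K α w v
  ia : ∀ (w : W) (f : Ags → W), (∀ α, B w (f α)) → ∃ v, B w v ∧ ∀ α, A α (f α) v
  unif : ∀ {α w w' v}, K α w v → B w w' → ∃ v', B v v' ∧ K α w' v'
  optO_of_A : ∀ {α w v}, A α w v → optO α w → optO α v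
  optS_of_K : ∀ {α w v}, K α w v → optS α w → optS α v
  exists_optO : ∀ α w, ∃ v, B w v ∧ optO α v
  exists_optS : ∀ α w, ∃ v, B w v ∧ optS α v

namespace KripkeModel

variable {Ags : Type u} {P : Type v} {W : Type w} (N : KripkeModel Ags P W)

/-- Truth at a world. -/
def Sat : W → Formula Ags P → Prop
  | w, atom p => N.val p w
  | w, neg φ => ¬ Sat w φ
  | w, conj φ ψ => Sat w φ ∧ Sat w ψ
  | w, box φ => ∀ v, N.B w v → Sat v φ
  | w, stit α φ => ∀ v, N.A α w v → Sat v φ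
  | w, know α φ => ∀ v, N.K α w v → Sat v φ
  | w, oughtO α φ => ∀ v, N.B w v → N.optO α v → Sat v φ
  | w, oughtS α φ => ∀ u v, N.K α w u → N.B u v → N.optS α v → Sat v φ

end KripkeModel

/-! ### The canonical Kripke model -/

section Canonical

variable {Ags : Type u} {P : Type v}

/-- The wanted `v` extends the theory generated by the `box`-part of `w` and one formula `stit (a i)
(g i)` from each agent's theory. If that were inconsistent, `w` would contain the necessity of the
negated conjunction of stits, although each stit is possible at `w`; this contradicts (IA).
Finiteness of `Ags` lets a single conjunction range over all agents. -/
theorem exists_canRel_stit [Finite Ags] (φ₀ : Formula Ags P) (w : MaxTheory Ags P)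
    (f : Ags → MaxTheory Ags P) (hf : ∀ α, canRel box w (f α)) :
    ∃ v, canRel box w v ∧ ∀ α, canRel (stit α) (f α) v := by
  obtain ⟨m, ⟨e⟩⟩ := Finite.exists_equiv_fin Ags
  obtain _ | n := m
  · exact ⟨w, isS5_box.equivalence.refl w, fun α => (e α).elim0⟩
  have hB := (isS5_box (Ags := Ags) (P := P)).isNormal
  have hS := fun α : Ags => (isS5_stit (P := P) α).isNormal
  let a : Fin (n + 1) → Ags := e.symm
  have htop : ∀ α, imp φ₀ φ₀ ∈ {φ | stit α φ ∈ f α} := fun α =>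
    ((hS α).isTheory _).taut fun t hn hc => by simp only [imp, hn, hc]; tauto
  have hT : IsTheory {ψ | ∃ g : Fin (n + 1) → Formula Ags P, (∀ i, stit (a i) (g i) ∈ f (a i)) ∧
      box (imp (bigAnd n fun i => stit (a i) (g i)) ψ) ∈ w} := by
    refine ⟨fun {φ} h => ⟨fun _ => imp φ₀ φ₀, fun i => htop _, w.of_provable (.necBox ?_)⟩, ?_⟩
    · refine .mp (.of_isTautology ?_) h
      intro t hn hc; simp only [imp, hn, hc]; tauto
    · rintro φ ψ ⟨g, hg, h⟩ ⟨g', hg', h'⟩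
      -- Two premises are merged agent by agent, because `stit` distributes over conjunction.
      refine ⟨fun i => conj (g i) (g' i), fun i => (hS _).mem_conj _ (hg i) (hg' i), ?_⟩
      have hmono : ∀ G : Fin (n + 1) → Formula Ags P,
          (∀ i, Provable (imp (conj (g i) (g' i)) (G i))) →
          Provable (imp (bigAnd n fun i => stit (a i) (conj (g i) (g' i)))
            (bigAnd n fun i => stit (a i) (G i))) := by
        intro G hG
        by_contra hcon
        obtain ⟨v, -, hv⟩ := IsTheory.provableSet.exists_maxTheory hcon
        rw [v.mem_imp, val_bigAnd (t := (· ∈ v)) fun _ _ => v.mem_conj,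
          val_bigAnd (t := (· ∈ v)) fun _ _ => v.mem_conj] at hv
        exact hv fun h i => (hS _).mem_mono v (hG i) (h i)
      have h1 := hmono g fun i => .of_isTautology fun t hn hc => by
        simp only [imp, hn, hc]; tauto
      have h2 := hmono g' fun i => .of_isTautology fun t hn hc => by
        simp only [imp, hn, hc]; tauto
      refine isS5_box.mem_iff_forall.2 fun v hv => ?_
      have h := hv _ h
      have h' := hv _ h'
      have h1 := v.of_provable h1
      have h2 := v.of_provable h2
      simp only [v.mem_imp] at h h' h1 h2 ⊢
      exact fun hx => h (h1 hx) (h' (h2 hx))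
  obtain ⟨v, hv, -⟩ := hT.exists_maxTheory (φ := conj φ₀ (neg φ₀)) (by
    rintro ⟨g, hg, h⟩
    have hd : (bigAnd n fun i => dia (stit (a i) (g i))) ∈ w := by
      rw [val_bigAnd (t := (· ∈ w)) fun _ _ => w.mem_conj]
      intro i
      rw [w.mem_dia]
      intro hb
      exact (f (a i)).mem_neg.1 (hf _ _ hb) (hg i)
    have hd' := w.mem_of_axm (.IA n a g e.symm.injective) hd
    refine w.mem_dia.1 hd' (hB.mem_mono w (.of_isTautology ?_) h)
    intro t hn hc; simp only [imp, hn, hc]; tauto)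
  refine ⟨v, fun ψ hψ => hv ψ ⟨fun _ => imp φ₀ φ₀, fun i => htop _, ?_⟩, fun α ψ hψ => ?_⟩
  · refine hB.mem_mono w (.of_isTautology ?_) hψ
    intro t hn hc; simp only [imp, hn, hc]; tauto
  · classical
    -- Take ψ for α and a tautology for every other agent; this puts `stit α ψ` itself into `v`.
    refine (isS5_stit α).mem_of_mem (hv _
      ⟨fun i => if a i = α then ψ else imp φ₀ φ₀, fun i => ?_, ?_⟩)
    · by_cases hi : a i = α
      · simpa [hi] using hψ
      · simpa [hi] using htop (a i)
    · refine w.of_provable (.necBox (.of_isTautology ?_))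
      intro t hn hc
      have := (val_bigAnd hc n
        fun i => stit (a i) (if a i = α then ψ else imp φ₀ φ₀)).1
      simp only [imp, hn, hc, not_and, not_not] at this ⊢
      intro h
      simpa [a] using this h (e α)

/-- By (A3) objective oughts are settled, hence constant on `box`-classes. -/
theorem oughtO_mem_iff {α : Ags} {φ : Formula Ags P} {w v : MaxTheory Ags P}
    (h : canRel box w v) : oughtO α φ ∈ w ↔ oughtO α φ ∈ v := by
  have hA := w.of_provable (.ax (.A3 α φ))
  rw [w.mem_disj] at hA
  rcases hA with hA | hA
  · exact ⟨fun _ => h _ hA, fun _ => isS5_box.mem_of_mem hA⟩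
  · have h1 := v.mem_neg.1 (h _ hA)
    have h2 := w.mem_neg.1 (isS5_box.mem_of_mem hA)
    exact ⟨fun h' => absurd h' h2, fun h' => absurd h' h1⟩

theorem oughtS_mem_of_know {α : Ags} {φ : Formula Ags P} {w v : MaxTheory Ags P}
    (h : canRel (know α) w v) (hw : oughtS α φ ∈ w) : oughtS α φ ∈ v :=
  isS5_box.mem_of_mem (h _ (w.mem_of_axm (.Cl α φ) hw))

theorem oughtS_mem_of_box {α : Ags} {φ : Formula Ags P} {w v : MaxTheory Ags P}
    (h : canRel box w v) (hw : oughtS α φ ∈ w) : oughtS α φ ∈ v :=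
  h _ ((isS5_know α).mem_of_mem (w.mem_of_axm (.Cl α φ) hw))

/-- This factorization turns the canonical relation of `oughtS` into the Kripke clause. The
intermediate `u` exists by (s.N); self-access of `v` holds because (Cl) carries subjective oughts
along `know` and `box`. -/
theorem canRel_oughtS_iff {α : Ags} {w v : MaxTheory Ags P} :
    canRel (oughtS α) w v ↔
      ∃ u, canRel (know α) w u ∧ canRel box u v ∧ canRel (oughtS α) v v := by
  constructor
  · intro h
    by_cases hF : Nonempty (Formula Ags P)
    · obtain ⟨φ₀⟩ := hF
      obtain ⟨u, hu, hu'⟩ := exists_canRel_of_sup (isS5_know α).isNormal isS5_box.isNormal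
        (w := w) (w' := v) φ₀ (by
          intro δ hδ hk
          -- From `K¬δ` this gives `K□¬□δ`, so by (s.N) `¬□δ` ought to hold and lies in `v`, against
          -- `□δ ∈ v`.
          have hp : Provable (imp (neg δ) (box (neg (box δ)))) := by
            by_contra hcon
            obtain ⟨x, -, hx⟩ := IsTheory.provableSet.exists_maxTheory hcon
            rw [x.mem_imp, x.mem_neg] at hx
            exact hx fun h' => isS5_box.mem_five fun h'' => h' (isS5_box.mem_of_mem h'')
          have h1 := (isS5_know α).isNormal.mem_mono w hp hk
          exact v.mem_neg.1 (h _ (w.mem_of_axm (.sN α _) h1)) hδ)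
      have huv := isS5_box.equivalence.symm hu'
      exact ⟨u, hu, huv, fun φ hφ => h φ (oughtS_mem_of_know ((isS5_know α).equivalence.symm hu)
        (oughtS_mem_of_box hu' hφ))⟩
    · exact ⟨w, fun φ => (hF ⟨φ⟩).elim, fun φ => (hF ⟨φ⟩).elim, fun φ => (hF ⟨φ⟩).elim⟩
  · rintro ⟨u, hu, huv, hv⟩ φ hφ
    exact hv φ (oughtS_mem_of_box huv (oughtS_mem_of_know hu hφ))

/-- The canonical model, on the maximal `Λ`-consistent sets. -/
def canonicalModel [Finite Ags] (φ₀ : Formula Ags P) :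
    KripkeModel Ags P (MaxTheory Ags P) where
  B := ⟨canRel box, isS5_box.equivalence⟩
  A α := ⟨canRel (stit α), (isS5_stit α).equivalence⟩
  K α := ⟨canRel (know α), (isS5_know α).equivalence⟩
  -- Optimal worlds are those that meet all their own obligations.
  optO α w := canRel (oughtO α) w w
  optS α w := canRel (oughtS α) w w
  val p w := atom p ∈ w
  A_le_B {α w _} h φ hφ := h φ (w.mem_conj.1 (w.mem_of_axm (.A2 α φ) hφ)).1
  A_le_K {α w _} h φ hφ := h φ (w.mem_of_axm (.OAC α φ) hφ)
  ia := exists_canRel_stit φ₀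
  unif {α w w' v} h h' := by
    obtain ⟨v', h1, h2⟩ := exists_canRel_of_sup isS5_box.isNormal (isS5_know α).isNormal
      (w := v) (w' := w') φ₀ (by
        intro δ hδ hb
        have h1 : dia (know α δ) ∈ w := w.mem_dia.2 fun hn => w'.mem_neg.1 (h' _ hn) hδ
        exact v.mem_dia.1 (h _ (w.mem_of_axm (.UnifH α δ) h1)) hb)
    exact ⟨v', h1, h2⟩
  optO_of_A {α w v} h hw φ hφ := by
    have hB : canRel box w v :=
      fun ψ hψ => h ψ (w.mem_conj.1 (w.mem_of_axm (.A2 α ψ) hψ)).1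
    exact h φ (hw _ (w.mem_of_axm (.A4 α φ) ((oughtO_mem_iff hB).2 hφ)))
  optS_of_K {α w v} h hw φ hφ :=
    h φ (hw _ (w.mem_of_axm (.A6 α φ)
      (oughtS_mem_of_know ((isS5_know α).equivalence.symm h) hφ)))
  -- (Oic) makes the obligations at `w` compatible with its necessities; the resulting world has the
  -- same obligations as `w`, so it meets its own.
  exists_optO α w := by
    obtain ⟨v, h1, h2⟩ := exists_canRel_of_sup isS5_box.isNormal (isNormal_oughtO α)
      (w := w) (w' := w) φ₀ (by
        intro δ hδ hb
        refine w.mem_dia.1 (w.mem_of_axm (.Oic α δ) hδ) (isS5_box.isNormal.mem_mono w ?_ hb)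
        refine .mp (.of_isTautology ?_) ((isS5_stit α).ax (.T δ))
        intro t hn hc; simp only [imp, hn, hc]; tauto)
    exact ⟨v, h1, fun φ hφ => h2 φ ((oughtO_mem_iff h1).2 hφ)⟩
  exists_optS α w := by
    obtain ⟨v, h1, h2⟩ := exists_canRel_of_sup isS5_box.isNormal (isNormal_oughtS α)
      (w := w) (w' := w) φ₀ (by
        intro δ hδ hb
        refine w.mem_dia.1 (w.mem_of_axm (.sOic α δ) hδ) (isS5_box.isNormal.mem_mono w ?_ hb)
        refine .mp (.of_isTautology ?_) ((isS5_know α).ax (.T δ))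
        intro t hn hc; simp only [imp, hn, hc]; tauto)
    exact ⟨v, h1, fun φ hφ => h2 φ (oughtS_mem_of_box (isS5_box.equivalence.symm h1) hφ)⟩

/-- The truth lemma for the canonical model. -/
theorem canonicalModel_sat [Finite Ags] (φ₀ φ : Formula Ags P) (w : MaxTheory Ags P) :
    (canonicalModel φ₀).Sat w φ ↔ φ ∈ w := by
  induction φ generalizing w with
  | atom p => rfl
  | neg φ ih => rw [KripkeModel.Sat, ih, w.mem_neg]
  | conj φ ψ ih ih' => rw [KripkeModel.Sat, ih, ih', w.mem_conj]
  | box φ ih =>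
    simp only [KripkeModel.Sat, ih]
    exact isS5_box.mem_iff_forall.symm
  | stit α φ ih =>
    simp only [KripkeModel.Sat, ih]
    exact (isS5_stit α).mem_iff_forall.symm
  | know α φ ih =>
    simp only [KripkeModel.Sat, ih]
    exact (isS5_know α).mem_iff_forall.symm
  | oughtO α φ ih =>
    simp only [KripkeModel.Sat, ih]
    refine ⟨fun h => (isNormal_oughtO α).mem_of_forall w fun v hv => ?_,
      fun h v hv hO => hO φ ((oughtO_mem_iff hv).1 h)⟩
    have hB : canRel box w v :=
      fun ψ hψ => hv ψ (w.mem_conj.1 (w.mem_of_axm (.A2 α ψ) hψ)).2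
    exact h v hB fun ψ hψ => hv ψ ((oughtO_mem_iff hB).2 hψ)
  | oughtS α φ ih =>
    simp only [KripkeModel.Sat, ih]
    refine ⟨fun h => (isNormal_oughtS α).mem_of_forall w fun v hv => ?_,
      fun h u v hu hv hS => canRel_oughtS_iff.2 ⟨u, hu, hv, hS⟩ φ h⟩
    obtain ⟨u, hu, huv, hS⟩ := canRel_oughtS_iff.1 hv
    exact h u v hu huv hS

end Canonical

/-! ### From Kripke models to branching-time models -/

namespace KripkeModel

variable {Ags : Type u} {P : Type v} {W : Type w} (N : KripkeModel Ags P W)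

/-- Moments: the `B`-classes, and a later moment for each world. -/
abbrev Moment : Type w := W ⊕ Quotient N.B

/-- The moment ordering: the class of `w` precedes `w`. -/
def lt (m m' : N.Moment) : Prop := ∃ w : W, m = .inr (Quotient.mk N.B w) ∧ m' = .inl w

/-- The moments on the history of a world. -/
def On (m : N.Moment) (w : W) : Prop := m = .inl w ∨ m = .inr (Quotient.mk N.B w)

variable {N}

@[simp] theorem on_inl {w v : W} : N.On (.inl w) v ↔ w = v := by simp [On]

@[simp] theorem on_inr {w v : W} : N.On (.inr (Quotient.mk N.B w)) v ↔ N.B w v := by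
  simp only [On, reduceCtorEq, false_or, Sum.inr.injEq]
  exact Quotient.eq

theorem on_of_lt {m m' : N.Moment} (h : N.lt m m') {w : W} : N.On m' w ↔ m' = .inl w := by
  obtain ⟨v, rfl, rfl⟩ := h
  simp

theorem exists_on (m : N.Moment) : ∃ w, N.On m w := by
  obtain w | q := m
  · exact ⟨w, .inl rfl⟩
  · obtain ⟨w, rfl⟩ := Quotient.exists_rep q
    exact ⟨w, .inr rfl⟩

theorem isChain_on (w : W) : IsChain N.lt {m | N.On m w} := by
  rintro m (rfl | rfl) m' (rfl | rfl) hne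
  · exact (hne rfl).elim
  · exact .inr ⟨w, rfl, rfl⟩
  · exact .inl ⟨w, rfl, rfl⟩
  · exact (hne rfl).elim

/-- A leaf is comparable only with its own root. -/
theorem subset_on_of_isChain {c : Set N.Moment} (hc : IsChain N.lt c) {w : W} (hw : .inl w ∈ c) :
    c ⊆ {m | N.On m w} := by
  intro m hm
  by_cases hne : m = .inl w
  · exact .inl hne
  · rcases hc hm hw hne with ⟨v, rfl, hv⟩ | ⟨v, hv, -⟩
    · rw [Sum.inl.injEq] at hv
      exact .inr (by rw [hv])
    · simp at hv

variable (N) in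
/-- The history of a world. -/
def hist (w : W) : History N.lt :=
  ⟨{m | N.On m w}, isChain_on w, fun _ hc h => h.antisymm (subset_on_of_isChain hc (h (.inl rfl)))⟩

theorem hist_surjective [Nonempty W] : Function.Surjective N.hist := by
  rintro ⟨c, hc⟩
  suffices h : ∃ w, c ⊆ {m | N.On m w} by
    obtain ⟨w, hw⟩ := h
    exact ⟨w, Subtype.ext (hc.2 (isChain_on w) hw).symm⟩
  by_cases h : ∃ w, .inl w ∈ c
  · obtain ⟨w, hw⟩ := h
    exact ⟨w, subset_on_of_isChain hc.1 hw⟩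
  -- Of two distinct comparable moments one is a leaf, so a chain without leaves has at most one
  -- element.
  · push Not at h
    by_cases hne : c.Nonempty
    · obtain ⟨m, hm⟩ := hne
      obtain ⟨w, hw⟩ := exists_on m
      refine ⟨w, fun m' hm' => ?_⟩
      by_cases hmm : m' = m
      · rwa [hmm]
      · rcases hc.1 hm' hm hmm with ⟨v, -, rfl⟩ | ⟨v, -, rfl⟩
        · exact (h _ hm).elim
        · exact (h _ hm').elim
    · rw [Set.not_nonempty_iff_eq_empty] at hne
      exact ⟨Classical.arbitrary W, by simp [hne]⟩

theorem hist_injective : Function.Injective N.hist := by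
  intro w v h
  have : (.inl w : N.Moment) ∈ (N.hist v).1 := h ▸ (.inl rfl : N.On (.inl w) w)
  exact on_inl.1 this

@[simp] theorem hist_mem_historiesAt {m : N.Moment} {w : W} :
    N.hist w ∈ HistoriesAt N.lt m ↔ N.On m w := Iff.rfl

variable (N) in
/-- The action of `α` at `m` that contains the history of `w`. -/
def action (α : Ags) (m : N.Moment) (w : W) : Set (History N.lt) :=
  {h | ∃ v, N.hist v = h ∧ N.On m v ∧ N.A α w v}

@[simp] theorem hist_mem_action {α : Ags} {m : N.Moment} {w v : W} :
    N.hist v ∈ N.action α m w ↔ N.On m v ∧ N.A α w v := by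
  refine ⟨?_, fun h => ⟨v, rfl, h⟩⟩
  rintro ⟨u, hu, h⟩
  rwa [← hist_injective hu]

theorem action_eq {α : Ags} (m : N.Moment) {w v : W} (h : N.A α w v) :
    N.action α m w = N.action α m v := by
  ext x
  exact exists_congr fun u => and_congr_right fun _ => and_congr_right fun _ =>
    ⟨(N.A α).trans ((N.A α).symm h), (N.A α).trans h⟩

/-- At a leaf there is only one world to choose; at a root this is independence in the Kripke model.
-/
theorem exists_on_of_A {m : N.Moment} (f : Ags → W) (hf : ∀ α, N.On m (f α)) :
    ∃ v, N.On m v ∧ ∀ α, N.A α (f α) v := by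
  obtain w | q := m
  · refine ⟨w, on_inl.2 rfl, fun α => ?_⟩
    rw [← on_inl.1 (hf α)]
  · obtain ⟨w, rfl⟩ := Quotient.exists_rep q
    simp only [on_inr] at hf ⊢
    exact N.ia w f hf

variable (N) in
/-- Indistinguishability of situations: both lie at the first, or both at the second moment of
their histories, and their worlds are related. -/
def sim (α : Ags) (s t : Situation N.lt) : Prop :=
  (s.m.isLeft ↔ t.m.isLeft) ∧ ∃ w v, N.hist w = s.h ∧ N.hist v = t.h ∧ N.K α w v

open Classical in
/-- The number of agents for which a world is optimal. -/
noncomputable def score (X : Ags → W → Prop) (w : W) : ℝ :=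
  ∑ᶠ α, if X α w then 1 else 0

/-- The terms of all agents other than α cancel. This is how one real value can serve every agent at
once. -/
theorem score_le_iff [Finite Ags] {X : Ags → W → Prop} {α : Ags} {w v : W}
    (h : ∀ β, β ≠ α → (X β w ↔ X β v)) : score X w ≤ score X v ↔ (X α w → X α v) := by
  classical
  have := Fintype.ofFinite Ags
  simp only [score, finsum_eq_sum_of_fintype]
  rw [← Finset.add_sum_erase _ _ (Finset.mem_univ α),
    ← Finset.add_sum_erase _ (fun β => if X β v then (1 : ℝ) else 0) (Finset.mem_univ α),
    Finset.sum_congr rfl fun β hβ => by rw [h β (Finset.ne_of_mem_erase hβ)], add_le_add_iff_right]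
  by_cases h1 : X α w <;> by_cases h2 : X α v <;> simp [h1, h2]

theorem optO_congr {α : Ags} {w v : W} (h : N.A α w v) : N.optO α w ↔ N.optO α v :=
  ⟨N.optO_of_A h, N.optO_of_A ((N.A α).symm h)⟩

theorem optS_congr {α : Ags} {w v : W} (h : N.K α w v) : N.optS α w ↔ N.optS α v :=
  ⟨N.optS_of_K h, N.optS_of_K ((N.K α).symm h)⟩

variable (N) in
/-- The world of a history. -/
noncomputable def world [Nonempty W] : History N.lt → W := Function.surjInv hist_surjective

@[simp] theorem hist_world [Nonempty W] (h : History N.lt) : N.hist (N.world h) = h :=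
  Function.surjInv_eq hist_surjective h

@[simp] theorem world_hist [Nonempty W] (w : W) : N.world (N.hist w) = w :=
  hist_injective (hist_world _)

variable (N) in
/-- The branching-time model of a Kripke model. -/
noncomputable def toBTModel [Nonempty W] : BTModel Ags P N.Moment where
  nonempty := ⟨.inl (Classical.arbitrary W)⟩
  lt := N.lt
  lt_irrefl := by rintro m ⟨w, rfl, h⟩; simp at h
  lt_trans := by rintro m₁ m₂ m₃ ⟨w, -, rfl⟩ ⟨v, h, -⟩; simp at h
  no_backward_branching := by
    rintro m m₁ m₂ ⟨w, rfl, rfl⟩ ⟨v, rfl, h⟩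
    rw [Sum.inl.injEq] at h
    exact .inl (by rw [h])
  choice α m := {L | ∃ w, N.On m w ∧ L = N.action α m w}
  choice_subset := by
    rintro α m _ ⟨w, -, rfl⟩ _ ⟨v, rfl, hv, -⟩
    exact hv
  choice_nonempty := by
    rintro α m _ ⟨w, hw, rfl⟩
    exact ⟨N.hist w, hist_mem_action.2 ⟨hw, (N.A α).refl w⟩⟩
  choice_partition := by
    intro α m h hh
    obtain ⟨w, rfl⟩ := hist_surjective h
    refine ⟨N.action α m w, ⟨⟨w, hh, rfl⟩, hist_mem_action.2 ⟨hh, (N.A α).refl w⟩⟩, ?_⟩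
    rintro _ ⟨⟨v, hv, rfl⟩, h⟩
    exact action_eq m (hist_mem_action.1 h).2
  nc := by
    rintro α m h hh h' hh' ⟨m', hm, h1, h2⟩ L -
    obtain ⟨w, rfl⟩ := hist_surjective h
    obtain ⟨v, rfl⟩ := hist_surjective h'
    -- A later moment is a leaf and lies on a single history, so the two histories coincide.
    have h1 := (on_of_lt hm).1 h1
    have h2 := (on_of_lt hm).1 h2
    rw [h1, Sum.inl.injEq] at h2
    rw [h2]
  ia := by
    intro m s hs
    choose f hf hfs using hs
    obtain ⟨v, hv, hA⟩ := exists_on_of_A f hf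
    refine ⟨N.hist v, hv, Set.mem_iInter.2 fun α => ?_⟩
    rw [hfs]
    exact hist_mem_action.2 ⟨hv, hA α⟩
  sim := N.sim
  sim_equivalence α := by
    refine ⟨fun s => ?_, ?_, ?_⟩
    · exact ⟨Iff.rfl, N.world s.h, N.world s.h, hist_world _, hist_world _, (N.K α).refl _⟩
    · rintro s t ⟨h, w, v, hw, hv, hK⟩
      exact ⟨h.symm, v, w, hv, hw, (N.K α).symm hK⟩
    · rintro s t r ⟨h, w, v, hw, hv, hK⟩ ⟨h', v', u, hv', hu, hK'⟩
      obtain rfl := hist_injective (hv.trans hv'.symm)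
      exact ⟨h.trans h', w, u, hw, hu, (N.K α).trans hK hK'⟩
  oac := by
    rintro α s s' t ⟨h, w, v, hw, hv, hK⟩ hs ⟨_, ⟨u, -, rfl⟩, h1, ⟨w', hw', -, hA'⟩⟩
    rw [← hw, hist_mem_action] at h1
    exact ⟨by rw [hs]; exact h, w', v, hw', hv,
      (N.K α).trans (N.A_le_K ((N.A α).trans ((N.A α).symm hA') h1.2)) hK⟩
  unif_h := by
    rintro α ⟨m, h, hm⟩ ⟨m', h', hm'⟩ ⟨m₁, h₁, hm₁⟩ ⟨hl, w, v, rfl, rfl, hK⟩ rfl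
    obtain ⟨w', rfl⟩ := hist_surjective h'
    rw [hist_mem_historiesAt] at hm hm' hm₁
    -- At a leaf the history cannot change; at a root the Kripke condition `unif` supplies the new
    -- one.
    rcases hm with rfl | rfl
    · obtain rfl := on_inl.1 hm'
      exact ⟨⟨m₁, N.hist v, hm₁⟩, rfl, hl, w, v, rfl, rfl, hK⟩
    · obtain ⟨v', hB, hK'⟩ := N.unif hK (on_inr.1 hm')
      rcases hm₁ with rfl | rfl
      · simp at hl
      · exact ⟨⟨_, N.hist v', on_inr.2 hB⟩, rfl, by simp, w', v', rfl, rfl, hK'⟩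
  valueO h := score N.optO (N.world h)
  valueS h := score N.optS (N.world h)
  val p := {x | N.val p (N.world x.2)}

/-! ### Dominance and truth at the roots -/

section Truth

variable [Nonempty W]

variable (N) in
/-- The situation of a world at the first moment of its history. -/
def situation (w : W) : Situation N.toBTModel.lt :=
  ⟨.inr (Quotient.mk N.B w), N.hist w, .inr rfl⟩

theorem situation_eq {m : N.Moment} {w v : W} (hm : m = .inr (Quotient.mk N.B w))
    (h : N.hist v ∈ HistoriesAt N.lt m) :
    (⟨m, N.hist v, h⟩ : Situation N.toBTModel.lt) = N.situation v := by
  subst hm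
  have : Quotient.mk N.B w = Quotient.mk N.B v := Quotient.sound (on_inr.1 h)
  simp [situation, this]

theorem mem_slice {X : Set (Situation N.toBTModel.lt)} {w v : W} :
    N.hist v ∈ N.toBTModel.slice X (.inr (Quotient.mk N.B w)) ↔
      N.B w v ∧ N.situation v ∈ X := by
  constructor
  · rintro ⟨hm, h⟩
    exact ⟨on_inr.1 hm, situation_eq rfl hm ▸ h⟩
  · rintro ⟨hB, h⟩
    exact ⟨on_inr.2 hB, (situation_eq rfl (on_inr.2 hB)).symm ▸ h⟩

theorem exists_situation_of_sim {α : Ags} {w : W} {t : Situation N.toBTModel.lt}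
    (h : N.toBTModel.sim α (N.situation w) t) : ∃ v, t = N.situation v ∧ N.K α w v := by
  obtain ⟨m, h', hm⟩ := t
  obtain ⟨hl, w', v, hw, rfl, hK⟩ := h
  obtain rfl := hist_injective hw
  rcases (show N.On m v from hm) with rfl | rfl
  · simp [situation] at hl
  · exact ⟨v, situation_eq rfl hm, hK⟩

theorem sim_situation {α : Ags} {w v : W} :
    N.toBTModel.sim α (N.situation w) (N.situation v) ↔ N.K α w v := by
  constructor
  · rintro ⟨-, w', v', hw, hv, hK⟩
    rwa [← hist_injective hw, ← hist_injective hv]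
  · exact fun h => ⟨by simp [situation], w, v, rfl, rfl, h⟩

/-- The witnessing situation may use another world of the class of `w`; `unif` moves it to `w`
itself. -/
theorem simMoment_iff {α : Ags} {w : W} {m : N.Moment} :
    N.toBTModel.simMoment α (.inr (Quotient.mk N.B w)) m ↔
      ∃ u, N.K α w u ∧ m = .inr (Quotient.mk N.B u) := by
  constructor
  · rintro ⟨⟨_, h, hm⟩, s', rfl, rfl, hs⟩
    obtain ⟨v, rfl⟩ := hist_surjective h
    replace hs : N.toBTModel.sim α (N.situation v) s' := situation_eq rfl hm ▸ hs
    obtain ⟨v', rfl, hK⟩ := exists_situation_of_sim hs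
    obtain ⟨u, hB, hK'⟩ := N.unif hK (N.B.symm (on_inr.1 hm))
    exact ⟨u, hK', congrArg Sum.inr (Quotient.sound hB)⟩
  · rintro ⟨u, hK, rfl⟩
    exact ⟨N.situation w, N.situation u, rfl, rfl, sim_situation.2 hK⟩

/-- All worlds of an action are `K`-related, so its cluster is cut out by the `K`-class of any one
of them. -/
theorem mem_cluster {α : Ags} {w v u x : W} (hv : N.B w v) :
    N.hist x ∈ N.toBTModel.cluster α (.inr (Quotient.mk N.B w))
        (N.action α (.inr (Quotient.mk N.B w)) v) (.inr (Quotient.mk N.B u)) ↔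
      N.B u x ∧ N.K α v x := by
  constructor
  · rintro ⟨⟨_, h, hm⟩, ⟨_, _, hm'⟩, rfl, hL, rfl, rfl, hs⟩
    obtain ⟨y, rfl⟩ := hist_surjective h
    have hy := situation_eq rfl hm
    have hx := situation_eq rfl hm'
    replace hs : N.toBTModel.sim α (N.situation y) (N.situation x) := hy ▸ hx ▸ hs
    rw [sim_situation] at hs
    exact ⟨on_inr.1 hm', (N.K α).trans (N.A_le_K (hist_mem_action.1 hL).2) hs⟩
  · rintro ⟨hB, hK⟩
    refine ⟨N.situation v, N.situation x, congrArg Sum.inr (Quotient.sound (N.B.symm hv)),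
      hist_mem_action.2 ⟨on_inr.2 hv, (N.A α).refl v⟩,
      congrArg Sum.inr (Quotient.sound (N.B.symm hB)), rfl, sim_situation.2 hK⟩

theorem A_of_mem_state {α β : Ags} (hβ : β ≠ α) {m : N.Moment} {S : Set (History N.lt)}
    (hS : S ∈ N.toBTModel.State α m) {w v : W} (hw : N.hist w ∈ S) (hv : N.hist v ∈ S) :
    N.A β w v := by
  obtain ⟨s, hs, rfl⟩ := hS
  obtain ⟨x, -, hx⟩ := hs β
  have key : ∀ y, N.hist y ∈ N.toBTModel.H m ∩ ⋂ γ ∈ {γ : Ags | γ ≠ α}, s γ → N.A β x y := by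
    intro y hy
    have := Set.mem_iInter₂.1 hy.2 β hβ
    rw [hx] at this
    exact (hist_mem_action.1 this).2
  exact (N.A β).trans ((N.A β).symm (key w hw)) (key v hv)

/-- Dominance is tested on states, and independence ensures that the test is not vacuous: the state
fixed by the others' actions at `w` also meets α's action at `v`. -/
theorem exists_state {α : Ags} {m : N.Moment} {w v : W} (hw : N.On m w) (hv : N.On m v) :
    ∃ S ∈ N.toBTModel.State α m, N.hist w ∈ S ∧ ∃ u, N.On m u ∧ N.A α v u ∧ N.hist u ∈ S := by
  classical
  obtain ⟨u, hu, hA⟩ := exists_on_of_A (fun β => if β = α then v else w)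
    (fun β => by split_ifs <;> assumption)
  refine ⟨_, ⟨fun β => N.action β m w, fun β => ⟨w, hw, rfl⟩, rfl⟩, ⟨hw, ?_⟩, u, hu,
    by simpa using hA α, hu, ?_⟩
  · exact Set.mem_iInter₂.2 fun β _ => hist_mem_action.2 ⟨hw, (N.A β).refl w⟩
  · refine Set.mem_iInter₂.2 fun β hβ => hist_mem_action.2 ⟨hu, ?_⟩
    have := hA β
    rwa [if_neg hβ] at this

/-- Inside a state the other agents' optimality is constant by `optO_of_A`, so comparing scores
compares α's optimality, which is constant on α's actions. -/
theorem domO_iff [Finite Ags] {α : Ags} {m : N.Moment} {w v : W} (hw : N.On m w)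
    (hv : N.On m v) :
    N.toBTModel.domO α m (N.action α m w) (N.action α m v) ↔ (N.optO α w → N.optO α v) := by
  constructor
  · intro h
    obtain ⟨S, hS, hwS, u, hu, hA, huS⟩ := exists_state (α := α) hw hv
    have hle := h S hS _ ⟨hist_mem_action.2 ⟨hw, (N.A α).refl w⟩, hwS⟩ _
      ⟨hist_mem_action.2 ⟨hu, hA⟩, huS⟩
    simp only [toBTModel, world_hist] at hle
    rw [score_le_iff fun β hβ => optO_congr (A_of_mem_state hβ hS hwS huS)] at hle
    rwa [optO_congr hA]
  · rintro h S hS _ ⟨⟨x, rfl, -, hx⟩, hxS⟩ _ ⟨⟨y, rfl, -, hy⟩, hyS⟩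
    simp only [toBTModel, world_hist]
    rwa [score_le_iff fun β hβ => optO_congr (A_of_mem_state hβ hS hxS hyS), ← optO_congr hx,
      ← optO_congr hy]

/-- As for `domO_iff`: subjective optimality is `K`-invariant, so it is constant over a cluster at
all moments. The moment of `w₀` itself already suffices for the forward direction. -/
theorem domS_iff [Finite Ags] {α : Ags} {w₀ w v : W} (hw : N.B w₀ w) (hv : N.B w₀ v) :
    N.toBTModel.domS α (.inr (Quotient.mk N.B w₀)) (N.action α (.inr (Quotient.mk N.B w₀)) w)
      (N.action α (.inr (Quotient.mk N.B w₀)) v) ↔ (N.optS α w → N.optS α v) := by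
  constructor
  · intro h
    obtain ⟨S, hS, hwS, u, hu, hA, huS⟩ := exists_state (α := α) (on_inr.2 hw) (on_inr.2 hv)
    have hle := h _ (simMoment_iff.2 ⟨w₀, (N.K α).refl _, rfl⟩) S hS _
      ⟨(mem_cluster hw).2 ⟨hw, (N.K α).refl w⟩, hwS⟩ _
      ⟨(mem_cluster hv).2 ⟨on_inr.1 hu, N.A_le_K hA⟩, huS⟩
    simp only [toBTModel, world_hist] at hle
    rw [score_le_iff fun β hβ =>
      optS_congr (N.A_le_K (A_of_mem_state hβ hS hwS huS))] at hle
    rwa [optS_congr (N.A_le_K hA)]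
  · rintro h m hm S hS h₁ ⟨hx, hxS⟩ h₂ ⟨hy, hyS⟩
    obtain ⟨u, -, rfl⟩ := simMoment_iff.1 hm
    obtain ⟨x, rfl⟩ := hist_surjective h₁
    obtain ⟨y, rfl⟩ := hist_surjective h₂
    replace hx := (mem_cluster hw).1 hx
    replace hy := (mem_cluster hv).1 hy
    simp only [toBTModel, world_hist]
    rwa [score_le_iff fun β hβ => optS_congr (N.A_le_K (A_of_mem_state hβ hS hxS hyS)),
      ← optS_congr hx.2, ← optS_congr hy.2]

theorem action_subset_slice {α : Ags} {w v : W} {X : Set (Situation N.toBTModel.lt)} :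
    N.action α (.inr (Quotient.mk N.B w)) v ⊆
        N.toBTModel.slice X (.inr (Quotient.mk N.B w)) ↔
      ∀ u, N.B w u → N.A α v u → N.situation u ∈ X := by
  constructor
  · intro h u hu hA
    exact (mem_slice.1 (h (hist_mem_action.2 ⟨on_inr.2 hu, hA⟩))).2
  · rintro h _ ⟨u, rfl, hu, hA⟩
    exact mem_slice.2 ⟨on_inr.1 hu, h u (on_inr.1 hu) hA⟩

theorem cluster_subset_slice {α : Ags} {w v u : W} (hv : N.B w v)
    {X : Set (Situation N.toBTModel.lt)} :
    N.toBTModel.cluster α (.inr (Quotient.mk N.B w))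
        (N.action α (.inr (Quotient.mk N.B w)) v) (.inr (Quotient.mk N.B u)) ⊆
        N.toBTModel.slice X (.inr (Quotient.mk N.B u)) ↔
      ∀ x, N.B u x → N.K α v x → N.situation x ∈ X := by
  constructor
  · intro h x hx hK
    exact (mem_slice.1 (h ((mem_cluster hv).2 ⟨hx, hK⟩))).2
  · intro h h' hh
    obtain ⟨x, rfl⟩ := hist_surjective h'
    replace hh := (mem_cluster hv).1 hh
    exact mem_slice.2 ⟨hh.1, h x hh.1 hh.2⟩

/-- Truth is preserved in the branching-time model of a Kripke model. -/
theorem toBTModel_sat [Finite Ags] (φ : Formula Ags P) (w : W) :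
    N.toBTModel.Sat (N.situation w) φ ↔ N.Sat w φ := by
  rw [BTModel.Sat]
  induction φ generalizing w with
  | atom p =>
    change N.val p (N.world (N.hist w)) ↔ N.val p w
    rw [world_hist]
  | neg φ ih => exact not_congr (ih w)
  | conj φ ψ ih ih' => exact and_congr (ih w) (ih' w)
  | box φ ih =>
    constructor
    · intro h v hv
      exact (ih v).1 (mem_slice.1 (h (show N.hist v ∈ _ from on_inr.2 hv))).2
    · intro h h' hh
      obtain ⟨v, rfl⟩ := hist_surjective h'
      exact mem_slice.2 ⟨on_inr.1 hh, (ih v).2 (h v (on_inr.1 hh))⟩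
  | stit α φ ih =>
    constructor
    · intro h v hv
      have hB := N.A_le_B hv
      exact (ih v).1 (mem_slice.1 (h ⟨_, ⟨w, on_inr.2 (N.B.refl w), rfl⟩,
        hist_mem_action.2 ⟨on_inr.2 (N.B.refl w), (N.A α).refl w⟩,
        hist_mem_action.2 ⟨on_inr.2 hB, hv⟩⟩)).2
    · rintro h _ ⟨_, ⟨u, -, rfl⟩, hw, ⟨v, rfl, hv, hA⟩⟩
      have hA' := (N.A α).trans ((N.A α).symm (hist_mem_action.1 hw).2) hA
      exact mem_slice.2 ⟨on_inr.1 hv, (ih v).2 (h v hA')⟩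
  | know α φ ih =>
    constructor
    · intro h v hv
      exact (ih v).1 (h _ (sim_situation.2 hv))
    · intro h t ht
      obtain ⟨v, rfl, hK⟩ := exists_situation_of_sim ht
      exact (ih v).2 (h v hK)
  | oughtO α φ ih =>
    constructor
    · intro h v hv hO
      by_contra hcon
      -- The action of an optimal world where φ fails would have to be strictly dominated, which is
      -- impossible.
      obtain ⟨_, ⟨v', hv', rfl⟩, ⟨-, hlt⟩, -⟩ := h _ ⟨v, on_inr.2 hv, rfl⟩ fun hsub =>
        hcon ((ih v).1 (action_subset_slice.1 hsub v hv ((N.A α).refl v)))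
      exact hlt ((domO_iff hv' (on_inr.2 hv)).2 fun _ => hO)
    · rintro h _ ⟨v, hv, rfl⟩ hsub
      -- An optimal action is the required dominator: everything weakly above it is optimal too, and
      -- an action where φ fails somewhere is not.
      obtain ⟨v', hv', hO'⟩ := N.exists_optO α w
      have hgood : ∀ x, N.On (.inr (Quotient.mk N.B w)) x → N.optO α x →
          N.action α (.inr (Quotient.mk N.B w)) x ⊆ N.toBTModel.slice
            (N.toBTModel.truth φ) (.inr (Quotient.mk N.B w)) := fun x hx hO =>
        action_subset_slice.2 fun u hu hA => (ih u).2 (h u hu (N.optO_of_A hA hO))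
      refine ⟨_, ⟨v', on_inr.2 hv', rfl⟩, ⟨(domO_iff hv (on_inr.2 hv')).2 fun _ => hO',
        fun hle => hsub (hgood v hv ((domO_iff (on_inr.2 hv') hv).1 hle hO'))⟩, ?_⟩
      rintro _ ⟨x, hx, rfl⟩ (heq | hle)
      · rw [heq]
        exact hgood v' (on_inr.2 hv') hO'
      · exact hgood x hx ((domO_iff (on_inr.2 hv') hx).1 hle hO')
  | oughtS α φ ih =>
    constructor
    · intro h u v hu hv hS
      by_contra hcon
      -- The counterexample `v` may lie at another moment; `unif` gives a `K`-related world `x` at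
      -- the moment of `w`, whose action has `v` in its cluster.
      obtain ⟨x, hx, hK⟩ := N.unif ((N.K α).symm hu) hv
      obtain ⟨_, ⟨v', hv', rfl⟩, ⟨-, hlt⟩, -⟩ := h _ ⟨x, on_inr.2 hx, rfl⟩
        ⟨_, simMoment_iff.2 ⟨u, hu, rfl⟩, fun hsub =>
          hcon ((ih v).1 ((cluster_subset_slice hx).1 hsub v hv ((N.K α).symm hK)))⟩
      exact hlt ((domS_iff (on_inr.1 hv') hx).2 fun _ => N.optS_of_K hK hS)
    · rintro h _ ⟨v, hv, rfl⟩ ⟨_, hm, hsub⟩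
      obtain ⟨v', hv', hS'⟩ := N.exists_optS α w
      have hgood : ∀ x, N.On (.inr (Quotient.mk N.B w)) x → N.optS α x →
          ∀ m, N.toBTModel.simMoment α (.inr (Quotient.mk N.B w)) m →
          N.toBTModel.cluster α (.inr (Quotient.mk N.B w))
            (N.action α (.inr (Quotient.mk N.B w)) x) m ⊆
            N.toBTModel.slice (N.toBTModel.truth φ) m := by
        intro x hx hS m hm
        obtain ⟨u, hu, rfl⟩ := simMoment_iff.1 hm
        exact (cluster_subset_slice (on_inr.1 hx)).2 fun y hy hK =>
          (ih y).2 (h u y hu hy (N.optS_of_K hK hS))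
      refine ⟨_, ⟨v', on_inr.2 hv', rfl⟩, ⟨(domS_iff (on_inr.1 hv) hv').2 fun _ => hS',
        fun hle => hsub (hgood v hv ((domS_iff hv' (on_inr.1 hv)).1 hle hS') _ hm)⟩, ?_⟩
      rintro _ ⟨x, hx, rfl⟩ (heq | hle)
      · rw [heq]
        exact hgood v' (on_inr.2 hv') hS'
      · exact hgood x hx ((domS_iff hv' (on_inr.1 hx)).1 hle hS')

end Truth

end KripkeModel

end StitKO

theorem mainTheorem1 {Ags : Type u} {P : Type v} [Finite Ags] [Countable P]
    (φ : StitKO.Formula Ags P) (hφ : StitKO.Consistent φ) :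
    ∃ (T : Type (max u v)) (M : StitKO.BTModel Ags P T) (s : StitKO.Situation M.lt),
      M.Sat s φ := by
  obtain ⟨w, -, hw⟩ := StitKO.IsTheory.provableSet.exists_maxTheory hφ
  have : Nonempty (StitKO.MaxTheory Ags P) := ⟨w⟩
  refine ⟨_, (StitKO.canonicalModel φ).toBTModel, (StitKO.canonicalModel φ).situation w, ?_⟩
  rw [StitKO.KripkeModel.toBTModel_sat, StitKO.canonicalModel_sat]
  by_contra h
  exact hw (w.mem_neg.2 h)
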